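/- Let $H^2=H^2(\mathbb D)$ be the Hardy space of functions $f(z)=\sum_{k\ge 0}a_kz^k$ analytic on the open unit disc $\mathbb D$ with $\|f\|^2=\sum_k|a_k|^2<\infty$. For an inner function $u$ let $K_u=H^2\ominus uH^2$ be the orthogonal complement of $uH^2$ in $H^2$, and for $t\ge 0$ let $\phi^t(z)=\exp\left(-t\,\frac{1-z}{1+z}\right)$. Let $\delta>0$, let $N\ge 1$ be an integer, let $w_1,\dots,w_N$ be (not necessarily distinct) points of the unit circle $\mathbb T$, and put $\widetilde p_N(z)=\prod_{j=1}^N(z+w_j)$. Let $c(\widetilde p_N)$ be the closed linear span in $H^2$ of $\{\widetilde p_N\phi^\lambda:0\le\lambda\le\delta\}$. Then $$c(\widetilde p_N)+\phi^\delta K_{z^N}=K_{z^{N+1}\phi^\delta},$$ where the left-hand side is the algebraic (not closed) sum of the two subspaces. Hence $c(\widetilde p_N)$ is contained in $K_{z^{N+1}\phi^\delta}$ and has codimension at most $N$ in it, that is, $\dim\bigl(K_{z^{N+1}\phi^\delta}/c(\widetilde p_N)\bigr)\le N$. -/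

import Mathlib

open scoped NNReal

namespace Hardy

noncomputable section

/-- `a` is square summable and `f z = ∑ a k * z ^ k` on the open unit disc.
(A function with such an expansion is automatically analytic on the disc.) -/
def HasCoeffs (f : Complex.UnitDisc → ℂ) (a : ℕ → ℂ) : Prop :=
  Summable (fun k => ‖a k‖ ^ 2) ∧ ∀ z : Complex.UnitDisc, HasSum (fun k => a k * (z : ℂ) ^ k) (f z)

theorem memlp_iff (a : ℕ → ℂ) : Memℓp a 2 ↔ Summable (fun k => ‖a k‖ ^ 2) := by
  rw [memℓp_gen_iff (by simp)]
  simp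

theorem HasCoeffs.add {f g : Complex.UnitDisc → ℂ} {a b : ℕ → ℂ}
    (hf : HasCoeffs f a) (hg : HasCoeffs g b) : HasCoeffs (f + g) (a + b) := by
  refine ⟨(memlp_iff _).1 (((memlp_iff _).2 hf.1).add ((memlp_iff _).2 hg.1)), fun z => ?_⟩
  simpa [add_mul] using (hf.2 z).add (hg.2 z)

theorem HasCoeffs.smul {f : Complex.UnitDisc → ℂ} {a : ℕ → ℂ} (c : ℂ)
    (hf : HasCoeffs f a) : HasCoeffs (c • f) (c • a) := by
  refine ⟨(memlp_iff _).1 (((memlp_iff _).2 hf.1).const_smul c), fun z => ?_⟩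
  simpa [mul_assoc] using (hf.2 z).mul_left c

theorem HasCoeffs.zero : HasCoeffs 0 0 :=
  ⟨by simp, fun z => by simp⟩

theorem coeffs_unique_of_hasSum {F : ℂ → ℂ} {a b : ℕ → ℂ}
    (ha : ∀ z : ℂ, ‖z‖ < 1 → HasSum (fun k => a k * z ^ k) (F z))
    (hb : ∀ z : ℂ, ‖z‖ < 1 → HasSum (fun k => b k * z ^ k) (F z)) : a = b := by
  have key : ∀ c : ℕ → ℂ, (∀ z : ℂ, ‖z‖ < 1 → HasSum (fun k => c k * z ^ k) (F z)) →
      HasFPowerSeriesAt F (FormalMultilinearSeries.ofScalars ℂ c) 0 := by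
    intro c hc
    rw [hasFPowerSeriesAt_iff]
    filter_upwards [Metric.ball_mem_nhds (0 : ℂ) one_pos] with z hz
    have := hc z (by simpa using hz)
    simpa [FormalMultilinearSeries.coeff_ofScalars, mul_comm] using this
  have h := (key a ha).eq_formalMultilinearSeries (key b hb)
  funext n
  have h2 := congrArg (fun p => FormalMultilinearSeries.coeff p n) h
  simpa [FormalMultilinearSeries.coeff_ofScalars] using h2

theorem HasCoeffs.unique {f : Complex.UnitDisc → ℂ} {a b : ℕ → ℂ}
    (ha : HasCoeffs f a) (hb : HasCoeffs f b) : a = b := by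
  classical
  refine coeffs_unique_of_hasSum
    (F := fun z => if hz : ‖z‖ < 1 then f (Complex.UnitDisc.mk z hz) else 0) ?_ ?_
  · intro z hz
    simpa [hz] using ha.2 (Complex.UnitDisc.mk z hz)
  · intro z hz
    simpa [hz] using hb.2 (Complex.UnitDisc.mk z hz)

/-- The vector space of functions on the disc with square summable Taylor coefficients. -/
def h2Submodule : Submodule ℂ (Complex.UnitDisc → ℂ) where
  carrier := {f | ∃ a : ℕ → ℂ, HasCoeffs f a}
  add_mem' := by
    rintro f g ⟨a, ha⟩ ⟨b, hb⟩
    exact ⟨a + b, ha.add hb⟩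
  zero_mem' := ⟨0, HasCoeffs.zero⟩
  smul_mem' := by
    rintro c f ⟨a, ha⟩
    exact ⟨c • a, ha.smul c⟩

/-- The Hardy space of the unit disc. It is a type of its own, so that it carries the
Hilbert norm below and not the topology of pointwise convergence. -/
def H2 : Type := h2Submodule

namespace H2

instance : AddCommGroup H2 := inferInstanceAs (AddCommGroup h2Submodule)
instance : Module ℂ H2 := inferInstanceAs (Module ℂ h2Submodule)

/-- The underlying function on the disc. -/
def toFun (f : H2) : Complex.UnitDisc → ℂ := f.1

instance : CoeFun H2 (fun _ => Complex.UnitDisc → ℂ) := ⟨toFun⟩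

@[ext] theorem ext {f g : H2} (h : ∀ z, f z = g z) : f = g := Subtype.ext (funext h)

@[simp] theorem add_apply (f g : H2) (z : Complex.UnitDisc) : (f + g) z = f z + g z := rfl
@[simp] theorem smul_apply (c : ℂ) (f : H2) (z : Complex.UnitDisc) : (c • f) z = c * f z := rfl

/-- The Taylor coefficients. -/
def coeff (f : H2) : ℕ → ℂ := f.2.choose

theorem hasCoeffs (f : H2) : HasCoeffs f f.coeff := f.2.choose_spec

/-- The Taylor coefficients as an element of `ℓ²`; this identification is bijective. -/
def toEll2 : H2 ≃ₗ[ℂ] lp (fun _ : ℕ => ℂ) 2 :=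
  LinearEquiv.ofBijective
    { toFun := fun f => ⟨f.coeff, (memlp_iff _).2 f.hasCoeffs.1⟩
      map_add' := fun f g =>
        Subtype.ext ((f + g).hasCoeffs.unique (f.hasCoeffs.add g.hasCoeffs))
      map_smul' := fun c f => Subtype.ext ((c • f).hasCoeffs.unique (f.hasCoeffs.smul c)) }
    (by
      constructor
      · intro f g h
        have h' : f.coeff = g.coeff := congrArg Subtype.val h
        ext z
        exact (f.hasCoeffs.2 z).unique (h' ▸ g.hasCoeffs.2 z)
      · intro a
        have hs : ∀ z : Complex.UnitDisc, Summable (fun k => a k * (z : ℂ) ^ k) := by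
          intro z
          refine Summable.of_norm_bounded
            ((summable_geometric_of_lt_one (norm_nonneg _) z.norm_lt_one).mul_left ‖a‖) ?_
          intro k
          rw [norm_mul, norm_pow]
          gcongr
          exact lp.norm_apply_le_norm two_ne_zero a k
        have hc : HasCoeffs (fun z => ∑' k, a k * (z : ℂ) ^ k) a :=
          ⟨(memlp_iff _).1 a.2, fun z => (hs z).hasSum⟩
        let f : H2 := ⟨fun z => ∑' k, a k * (z : ℂ) ^ k, a, hc⟩
        exact ⟨f, Subtype.ext (f.hasCoeffs.unique hc)⟩)

@[simp] theorem toEll2_apply (f : H2) (k : ℕ) : toEll2 f k = f.coeff k := rfl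

instance : NormedAddCommGroup H2 :=
  NormedAddCommGroup.induced H2 (lp (fun _ : ℕ => ℂ) 2) toEll2.toLinearMap toEll2.injective

/-- The inner product: `⟪f, g⟫ = ∑ conj (a k) * b k` for the Taylor coefficients `a`, `b` of
`f`, `g`. -/
instance : InnerProductSpace ℂ H2 where
  norm_smul_le c f := by
    change ‖toEll2 (c • f)‖ ≤ ‖c‖ * ‖toEll2 f‖
    rw [map_smul]
    exact norm_smul_le c (toEll2 f)
  inner f g := inner ℂ (toEll2 f) (toEll2 g)
  norm_sq_eq_re_inner f := norm_sq_eq_re_inner (𝕜 := ℂ) (toEll2 f)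
  conj_inner_symm f g := inner_conj_symm (𝕜 := ℂ) (toEll2 f) (toEll2 g)
  add_left f g h := by simp only [map_add, inner_add_left]
  smul_left f g c := by simp only [map_smul, inner_smul_left]

theorem inner_eq_tsum (f g : H2) :
    inner ℂ f g = ∑' k, (starRingEnd ℂ) (f.coeff k) * g.coeff k := by
  change inner ℂ (toEll2 f) (toEll2 g) = _
  rw [lp.inner_eq_tsum]
  simp [mul_comm]

theorem norm_sq_eq_tsum (f : H2) : ‖f‖ ^ 2 = ∑' k, ‖f.coeff k‖ ^ 2 := by
  change ‖toEll2 f‖ ^ 2 = _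
  have := lp.norm_rpow_eq_tsum (p := 2) (by simp) (toEll2 f)
  simpa using this

end H2

/-- The algebra of bounded analytic functions on the disc. -/
def Hinf : Subalgebra ℂ (Complex.UnitDisc → ℂ) where
  carrier := {u | (∃ U : ℂ → ℂ, DifferentiableOn ℂ U (Metric.ball 0 1) ∧
      ∀ z : Complex.UnitDisc, u z = U z) ∧ ∃ C : ℝ, ∀ z, ‖u z‖ ≤ C}
  mul_mem' := by
    rintro u v ⟨⟨U, hU, hu⟩, C, hC⟩ ⟨⟨V, hV, hv⟩, D, hD⟩
    refine ⟨⟨U * V, hU.mul hV, fun z => by simp [hu, hv]⟩, C * D, fun z => ?_⟩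
    rw [Pi.mul_apply, norm_mul]
    exact mul_le_mul (hC z) (hD z) (norm_nonneg _) ((norm_nonneg _).trans (hC z))
  add_mem' := by
    rintro u v ⟨⟨U, hU, hu⟩, C, hC⟩ ⟨⟨V, hV, hv⟩, D, hD⟩
    exact ⟨⟨U + V, hU.add hV, fun z => by simp [hu, hv]⟩, C + D,
      fun z => (norm_add_le _ _).trans (add_le_add (hC z) (hD z))⟩
  algebraMap_mem' c := ⟨⟨fun _ => c, differentiableOn_const c, fun _ => rfl⟩, ‖c‖, fun _ => le_rfl⟩

/-- The `L²` norm of an absolutely convergent Fourier series with nonnegative frequencies. -/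
theorem exists_toLp (c : ℕ → ℂ) (hc : Summable fun k => ‖c k‖) :
    ∃ G : C(AddCircle (1 : ℝ), ℂ),
      (∀ x, HasSum (fun k : ℕ => c k * (fourier k x : ℂ)) (G x)) ∧
      HasSum (fun k => ‖c k‖ ^ 2)
        (‖ContinuousMap.toLp (E := ℂ) 2 AddCircle.haarAddCircle ℂ G‖ ^ 2) := by
  have hs : Summable (fun k : ℕ => c k • (fourier (k : ℤ) : C(AddCircle (1 : ℝ), ℂ))) := by
    refine Summable.of_norm ?_
    refine hc.congr fun k => ?_
    rw [norm_smul, fourier_norm, mul_one]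
  refine ⟨∑' k : ℕ, c k • (fourier (k : ℤ) : C(AddCircle (1 : ℝ), ℂ)), fun x => ?_, ?_⟩
  · simpa using hs.hasSum.mapL (ContinuousMap.evalCLM ℂ x)
  · have h1 := hs.hasSum.mapL
      (ContinuousMap.toLp (E := ℂ) 2 (AddCircle.haarAddCircle (T := 1)) ℂ)
    have h2 := (h1.norm).pow 2
    refine h2.congr fun s => ?_
    have ho : Orthonormal ℂ (fun k : ℕ => fourierLp (T := 1) 2 (k : ℤ)) :=
      orthonormal_fourier.comp _ Nat.cast_injective
    have h3 := ho.inner_sum c c s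
    simp only [map_smul]
    have h4 := norm_sq_eq_re_inner (𝕜 := ℂ) (∑ i ∈ s, c i • fourierLp (T := 1) 2 (i : ℤ))
    rw [h3] at h4
    refine h4.trans ?_
    rw [map_sum]
    refine Finset.sum_congr rfl fun i _ => ?_
    rw [RCLike.conj_mul]
    norm_cast

theorem hasSum_mul {a c : ℕ → ℂ} {z x y : ℂ} (hc : HasSum (fun k => c k * z ^ k) x)
    (ha : HasSum (fun k => a k * z ^ k) y) :
    HasSum (fun n => (∑ p ∈ Finset.HasAntidiagonal.antidiagonal n, c p.1 * a p.2) * z ^ n) (x * y) := by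
  have hc' := summable_norm_iff.2 hc.summable
  have ha' := summable_norm_iff.2 ha.summable
  have h1 := (summable_norm_sum_mul_antidiagonal_of_summable_norm hc' ha').of_norm.hasSum
  rw [← tsum_mul_tsum_eq_tsum_sum_antidiagonal_of_summable_norm hc' ha', hc.tsum_eq,
    ha.tsum_eq] at h1
  refine h1.congr_fun fun n => ?_
  rw [Finset.sum_mul]
  refine Finset.sum_congr rfl fun p hp => ?_
  rw [← Finset.HasAntidiagonal.mem_antidiagonal.1 hp, pow_add]
  ring

/-- A bounded analytic function multiplies `H²` into itself. -/
theorem mul_mem (u : Hinf) (f : H2) : u.1 * f.toFun ∈ h2Submodule := by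
  obtain ⟨u, ⟨U, hU, hu⟩, C, hC⟩ := u
  obtain ⟨f, a, ha⟩ := f
  have hC0 : 0 ≤ C := (norm_nonneg _).trans (hC 0)
  change u * f ∈ h2Submodule
  let c : ℕ → ℂ := fun n => ((n.factorial : ℂ))⁻¹ * iteratedDeriv n U 0
  have hcs : ∀ z : Complex.UnitDisc, HasSum (fun k => c k * (z : ℂ) ^ k) (u z) := by
    intro z
    have h := Complex.hasSum_taylorSeries_on_ball (r := 1) hU
      (z := (z : ℂ)) (by simpa using z.norm_lt_one)
    rw [hu]
    refine h.congr_fun fun n => ?_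
    simp only [c, sub_zero, smul_eq_mul]
    ring
  let b : ℕ → ℂ := fun n => ∑ p ∈ Finset.HasAntidiagonal.antidiagonal n, c p.1 * a p.2
  have hb : ∀ z : Complex.UnitDisc, HasSum (fun k => b k * (z : ℂ) ^ k) (u z * f z) :=
    fun z => hasSum_mul (hcs z) (ha.2 z)
  have key : ∀ (s : Finset ℕ) (r : ℝ), 0 ≤ r → r < 1 →
      ∑ k ∈ s, ‖b k * (r : ℂ) ^ k‖ ^ 2 ≤ C ^ 2 * ∑' k, ‖a k‖ ^ 2 := by
    intro s r hr0 hr1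
    have hrn : ‖(r : ℂ)‖ < 1 := by simpa [abs_of_nonneg hr0] using hr1
    let R : Complex.UnitDisc := Complex.UnitDisc.mk r hrn
    obtain ⟨Ga, hGa, hGa2⟩ := exists_toLp _ (summable_norm_iff.2 (ha.2 R).summable)
    obtain ⟨Gb, hGb, hGb2⟩ := exists_toLp _ (summable_norm_iff.2 (hb R).summable)
    have hpt : ∀ x, ‖Gb x‖ ≤ C * ‖Ga x‖ := by
      intro x
      have hx : ‖(r : ℂ) * (fourier 1 x : ℂ)‖ < 1 := by
        rw [norm_mul, fourier_one, Circle.norm_coe, mul_one]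
        exact hrn
      let z : Complex.UnitDisc := Complex.UnitDisc.mk _ hx
      have hpow : ∀ k : ℕ, (z : ℂ) ^ k = (R : ℂ) ^ k * (fourier (k : ℤ) x : ℂ) := by
        intro k
        change ((r : ℂ) * (fourier 1 x : ℂ)) ^ k = (r : ℂ) ^ k * _
        rw [mul_pow, fourier_one, fourier_apply, natCast_zsmul, AddCircle.toCircle_nsmul,
          Circle.coe_pow]
      have e1 : Ga x = f z := by
        refine (hGa x).unique ((ha.2 z).congr_fun fun k => ?_)
        rw [hpow, mul_assoc]
      have e2 : Gb x = u z * f z := by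
        refine (hGb x).unique ((hb z).congr_fun fun k => ?_)
        rw [hpow, mul_assoc]
      rw [e1, e2, norm_mul]
      exact mul_le_mul_of_nonneg_right (hC z) (norm_nonneg _)
    have hn := MeasureTheory.Lp.norm_le_mul_norm_of_ae_le_mul (c := C)
      (f := ContinuousMap.toLp (E := ℂ) 2 AddCircle.haarAddCircle ℂ Gb)
      (g := ContinuousMap.toLp (E := ℂ) 2 AddCircle.haarAddCircle ℂ Ga) (by
        filter_upwards [ContinuousMap.coeFn_toLp (p := 2) (𝕜 := ℂ) AddCircle.haarAddCircle Gb,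
          ContinuousMap.coeFn_toLp (p := 2) (𝕜 := ℂ) AddCircle.haarAddCircle Ga] with x h1 h2
        rw [h1, h2]
        exact hpt x)
    calc ∑ k ∈ s, ‖b k * (r : ℂ) ^ k‖ ^ 2
        ≤ ‖ContinuousMap.toLp (E := ℂ) 2 AddCircle.haarAddCircle ℂ Gb‖ ^ 2 :=
          sum_le_hasSum s (fun _ _ => by positivity) hGb2
      _ ≤ (C * ‖ContinuousMap.toLp (E := ℂ) 2 AddCircle.haarAddCircle ℂ Ga‖) ^ 2 := by
          gcongr
      _ = C ^ 2 * ‖ContinuousMap.toLp (E := ℂ) 2 AddCircle.haarAddCircle ℂ Ga‖ ^ 2 := by ring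
      _ ≤ C ^ 2 * ∑' k, ‖a k‖ ^ 2 := by
          gcongr
          refine hasSum_le (fun k => ?_) hGa2 ha.1.hasSum
          change ‖a k * (r : ℂ) ^ k‖ ^ 2 ≤ _
          gcongr
          rw [norm_mul, norm_pow]
          exact mul_le_of_le_one_right (norm_nonneg _) (pow_le_one₀ (norm_nonneg _) hrn.le)
  refine ⟨b, summable_of_sum_le (c := C ^ 2 * ∑' k, ‖a k‖ ^ 2) (fun _ => by positivity)
    fun s => ?_, hb⟩
  have hcont : Continuous fun r : ℝ => ∑ k ∈ s, ‖b k * (r : ℂ) ^ k‖ ^ 2 := by fun_prop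
  have ht := (hcont.tendsto 1).mono_left (nhdsWithin_le_nhds (s := Set.Iio 1))
  simp only [Complex.ofReal_one, one_pow, mul_one] at ht
  refine le_of_tendsto ht ?_
  filter_upwards [Ioo_mem_nhdsLT (zero_lt_one (α := ℝ))] with r hr
  exact key s r hr.1.le hr.2

/-- The multiplication operator `f ↦ u f` on `H²`, for a bounded analytic function `u`. -/
def mul (u : Hinf) : H2 →ₗ[ℂ] H2 where
  toFun f := ⟨u.1 * f.toFun, mul_mem u f⟩
  map_add' f g := H2.ext fun z => mul_add (u.1 z) (f z) (g z)
  map_smul' c f := H2.ext fun z => mul_left_comm (u.1 z) c (f z)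

@[simp] theorem mul_apply (u : Hinf) (f : H2) (z : Complex.UnitDisc) :
    mul u f z = u.1 z * f z := rfl

/-- The constant function `1`. -/
def one : H2 := ⟨1, Pi.single 0 1, by
  refine ⟨summable_of_ne_finset_zero (s := {0}) fun k hk => ?_, fun z => ?_⟩
  · simp [Pi.single_eq_of_ne (Finset.notMem_singleton.1 hk)]
  · simpa using hasSum_single (f := fun k => (Pi.single 0 1 : ℕ → ℂ) k * (z : ℂ) ^ k) 0
      fun k hk => by simp [Pi.single_eq_of_ne hk]⟩

@[simp] theorem one_apply (z : Complex.UnitDisc) : one z = 1 := rfl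

/-- The inclusion of the bounded analytic functions into `H²`. -/
def toH2 (u : Hinf) : H2 := mul u one

@[simp] theorem toH2_apply (u : Hinf) (z : Complex.UnitDisc) : toH2 u z = u.1 z := mul_one _

/-- The identity function `z`. -/
def coord : Hinf :=
  ⟨fun z => z, ⟨fun z => z, differentiableOn_id, fun _ => rfl⟩, 1, fun z => z.norm_lt_one.le⟩

/-- `φ ^ t`, that is, `z ↦ exp (-t (1 - z) / (1 + z))`, for `t ≥ 0`. -/
def phi (t : ℝ≥0) : Hinf :=
  ⟨fun z => Complex.exp (-(t : ℂ) * ((1 - z) / (1 + z))),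
    ⟨fun z => Complex.exp (-(t : ℂ) * ((1 - z) / (1 + z))), by
      refine DifferentiableOn.cexp (DifferentiableOn.const_mul (DifferentiableOn.div
        (by fun_prop) (by fun_prop) fun z hz => ?_) _)
      exact Complex.UnitDisc.one_add_coe_ne_zero (Complex.UnitDisc.mk z (by simpa using hz)),
      fun _ => rfl⟩,
    1, fun z => by
      rw [Complex.norm_exp, Real.exp_le_one_iff]
      have h : 0 ≤ ((1 - (z : ℂ)) / (1 + z)).re := by
        have hz := z.normSq_lt_one
        rw [Complex.normSq_apply] at hz
        rw [Complex.div_re, ← add_div]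
        refine div_nonneg ?_ (Complex.normSq_nonneg _)
        simp only [Complex.sub_re, Complex.one_re, Complex.add_re, Complex.sub_im,
          Complex.one_im, Complex.add_im]
        nlinarith
      have e : -(t : ℂ) * ((1 - (z : ℂ)) / (1 + z)) =
          ((-(t : ℝ) : ℝ) : ℂ) * ((1 - (z : ℂ)) / (1 + z)) := by push_cast; rfl
      rw [e, Complex.re_ofReal_mul]
      have := mul_nonneg t.2 h
      simp only [NNReal.val_eq_coe] at this
      linarith⟩

/-- The polynomial `∏ j, (z + w j)`. -/
def polyTilde {N : ℕ} (w : Fin N → Circle) : Hinf :=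
  ∏ j, (coord + algebraMap ℂ Hinf (w j))

theorem polyTilde_apply {N : ℕ} (w : Fin N → Circle) (z : Complex.UnitDisc) :
    (polyTilde w).1 z = ∏ j, ((z : ℂ) + w j) := by
  change (Pi.evalAlgHom ℂ (fun _ : Complex.UnitDisc => ℂ) z) (Hinf.val (polyTilde w)) = _
  rw [polyTilde, map_prod, map_prod]
  rfl

/-- `K_u`, the orthogonal complement of `u H²` in `H²`. -/
def modelSpace (u : Hinf) : Submodule ℂ H2 := (LinearMap.range (mul u))ᗮ

/-- `c(g)`, the closed linear span in `H²` of the functions `g φ ^ t` with `0 ≤ t ≤ δ`. -/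
def cyclicSpace (δ : ℝ≥0) (g : Hinf) : Submodule ℂ H2 :=
  (Submodule.span ℂ ((fun t => toH2 (g * phi t)) '' Set.Icc 0 δ)).topologicalClosure

end

end Hardy

namespace Hardy

noncomputable section

open Filter Topology MeasureTheory Polynomial
open scoped InnerProductSpace

/-! Write `T_u` for multiplication by `u`, `p` for the polynomial and `K` for the right-hand model
space. Multiplication by `φ^t` is isometric and `deg p = N < N + 1`, so both summands lie in `K`.
The first is closed and the second finite-dimensional, so their sum is closed; it remains to see
that any `g` in `K` orthogonal to both vanishes (`eq_zero_of_orthogonal`).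

Put `v = T_{φ^δ}* g`. Membership in `K` makes `v` a polynomial of degree at most `N`; orthogonality
to `φ^δ K_{z^N}` removes its coefficients below `N`, and orthogonality to `p φ^δ` removes the last
one because `p` is monic. So `v = 0`. On the other hand `T_p* g` is orthogonal to `φ^t` for all `t ≤
δ`, hence equals `φ^δ T_{φ^δ}* T_p* g = φ^δ T_p* v = 0` (`eq_mulCLM_adjoint`). As `p` is outer,
`T_p*` is injective (`denseRange_polyTilde`), and `g = 0`.

The divisibility step rests on the density of the span of all `φ^t`, `t ≥ 0`
(`eq_zero_of_inner_phi`), which comes from the Laplace integral `∫ e^{-t} φ^{s+t} dt = (1 + z) φ^s /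
2`: the orthogonal complement of the family is invariant under the backward shift. -/

namespace H2

/-! ### `H²` as a Hilbert space: completeness, point evaluations, polynomials. -/

/-- The Taylor coefficients identify `H²` isometrically with `ℓ²`. -/
def toEll2Isometry : H2 ≃ₗᵢ[ℂ] lp (fun _ : ℕ => ℂ) 2 := ⟨toEll2, fun _ => rfl⟩

instance : CompleteSpace H2 :=
  toEll2Isometry.toIsometryEquiv.completeSpace

theorem ext_coeff {f g : H2} (h : ∀ k, f.coeff k = g.coeff k) : f = g :=
  toEll2.injective (Subtype.ext (funext h))

theorem norm_coeff_le (f : H2) (k : ℕ) : ‖f.coeff k‖ ≤ ‖f‖ :=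
  lp.norm_apply_le_norm two_ne_zero (toEll2 f) k

/-- Evaluation at a point of the disc. -/
def eval (z : Complex.UnitDisc) : H2 →L[ℂ] ℂ :=
  LinearMap.mkContinuous ⟨⟨fun f => f z, fun _ _ => rfl⟩, fun _ _ => rfl⟩ (1 - ‖(z : ℂ)‖)⁻¹ (by
    intro f
    have h1 := (hasSum_geometric_of_lt_one (norm_nonneg _) z.norm_lt_one).mul_left ‖f‖
    have h2 := tsum_of_norm_bounded (f := fun k => f.coeff k * (z : ℂ) ^ k) h1 fun k => by
      rw [norm_mul, norm_pow]
      gcongr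
      exact f.norm_coeff_le k
    rw [(f.hasCoeffs.2 z).tsum_eq, mul_comm] at h2
    exact h2)

@[simp] theorem eval_apply (z : Complex.UnitDisc) (f : H2) : eval z f = f z := rfl

/-- A polynomial as an element of `H²`. -/
def ofPoly : ℂ[X] →ₗ[ℂ] H2 where
  toFun q := ⟨fun z => q.eval (z : ℂ), q.coeff, by
    refine ⟨summable_of_ne_finset_zero (s := q.support) fun k hk => ?_, fun z => ?_⟩
    · simp [notMem_support_iff.1 hk]
    · change HasSum _ (q.eval (z : ℂ))
      rw [eval_eq_sum]
      exact hasSum_sum_of_ne_finset_zero fun k hk => by simp [notMem_support_iff.1 hk]⟩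
  map_add' p q := H2.ext fun z => eval_add
  map_smul' c q := H2.ext fun z => by
    change (c • q).eval (z : ℂ) = c * q.eval (z : ℂ)
    simp

@[simp] theorem ofPoly_apply (q : ℂ[X]) (z : Complex.UnitDisc) : ofPoly q z = q.eval (z : ℂ) := rfl

@[simp] theorem coeff_ofPoly (q : ℂ[X]) : (ofPoly q).coeff = q.coeff := by
  refine (ofPoly q).hasCoeffs.unique ⟨?_, fun z => ?_⟩
  · exact summable_of_ne_finset_zero (s := q.support) fun k hk => by simp [notMem_support_iff.1 hk]
  · rw [ofPoly_apply, eval_eq_sum]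
    exact hasSum_sum_of_ne_finset_zero fun k hk => by simp [notMem_support_iff.1 hk]

theorem inner_ofPoly_X_pow (k : ℕ) (f : H2) : ⟪ofPoly (X ^ k), f⟫_ℂ = f.coeff k := by
  rw [inner_eq_tsum, tsum_eq_single k]
  · simp
  · intro j hj
    simp [coeff_X_pow, hj]

theorem ofPoly_one : ofPoly 1 = one := H2.ext fun z => by simp

theorem inner_one (f : H2) : ⟪one, f⟫_ℂ = f 0 := by
  rw [← ofPoly_one, ← pow_zero X, inner_ofPoly_X_pow]
  have h := f.hasCoeffs.2 0
  refine (hasSum_single 0 fun k hk => ?_).unique h |>.symm ▸ ?_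
  · simp [hk]
  · simp

theorem eq_zero_of_inner_X_pow {f : H2} (h : ∀ k : ℕ, ⟪ofPoly (X ^ k), f⟫_ℂ = 0) : f = 0 :=
  ext_coeff fun k => by
    rw [← inner_ofPoly_X_pow, h, ← inner_ofPoly_X_pow, inner_zero_right]

theorem denseRange_ofPoly : DenseRange ofPoly := by
  have h : (LinearMap.range ofPoly).topologicalClosure = ⊤ := by
    rw [Submodule.topologicalClosure_eq_top_iff, Submodule.eq_bot_iff]
    exact fun f hf => eq_zero_of_inner_X_pow fun k => hf _ ⟨_, rfl⟩
  exact Submodule.dense_iff_topologicalClosure_eq_top.2 h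

end H2

open H2

/-! ### Multiplication operators. -/

/-- Multiplication by a bounded analytic function is a bounded operator. -/
def mulCLM (u : Hinf) : H2 →L[ℂ] H2 :=
  -- Point evaluations are continuous and separate functions, so the graph is closed and no norm
  -- estimate is needed.
  ContinuousLinearMap.ofSeqClosedGraph (g := mul u) fun f x y hx hy => H2.ext fun z => by
    have h1 := (((eval z).continuous.tendsto x).comp hx).const_mul (u.1 z)
    have h2 := ((eval z).continuous.tendsto y).comp hy
    exact tendsto_nhds_unique h2 h1

@[simp] theorem mulCLM_apply (u : Hinf) (f : H2) (z : Complex.UnitDisc) :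
    mulCLM u f z = u.1 z * f z := rfl

theorem mulCLM_eq_mul (u : Hinf) (f : H2) : mulCLM u f = mul u f := rfl

theorem mulCLM_mul (u v : Hinf) (f : H2) : mulCLM (u * v) f = mulCLM u (mulCLM v f) :=
  H2.ext fun z => by
    change u.1 z * v.1 z * f z = u.1 z * (v.1 z * f z)
    ring

theorem mulCLM_comm (u v : Hinf) (f : H2) : mulCLM u (mulCLM v f) = mulCLM v (mulCLM u f) := by
  rw [← mulCLM_mul, mul_comm, mulCLM_mul]

theorem mulCLM_coord_pow (n : ℕ) (q : ℂ[X]) : mulCLM (coord ^ n) (ofPoly q) = ofPoly (X ^ n * q) :=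
  H2.ext fun z => by
    have h : (coord ^ n).1 z = (z : ℂ) ^ n := by
      change (coord.1 ^ n) z = _
      rw [Pi.pow_apply]
      rfl
    simp [h]

/-! ### `L²` means over circles and the isometry property of `φ^t`. -/

/-- Parseval's identity for an absolutely convergent Fourier series with nonnegative
frequencies. -/
theorem hasSum_norm_sq {c : ℕ → ℂ} (hc : Summable fun k => ‖c k‖) {G : AddCircle (1 : ℝ) → ℂ}
    (hG : ∀ x, HasSum (fun k : ℕ => c k * (fourier k x : ℂ)) (G x)) :
    Continuous G ∧
      HasSum (fun k => ‖c k‖ ^ 2) (∫ x, ‖G x‖ ^ 2 ∂(AddCircle.haarAddCircle (T := 1))) := by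
  obtain ⟨F, hF, hF2⟩ := exists_toLp c hc
  obtain rfl : G = F := funext fun x => (hG x).unique (hF x)
  refine ⟨F.continuous, ?_⟩
  convert hF2 using 1
  have h := norm_sq_eq_re_inner (𝕜 := ℂ)
    (ContinuousMap.toLp (E := ℂ) 2 (AddCircle.haarAddCircle (T := 1)) ℂ F)
  rw [ContinuousMap.inner_toLp] at h
  rw [h]
  have e : ∀ x, F x * (starRingEnd ℂ) (F x) = ((‖F x‖ ^ 2 : ℝ) : ℂ) := fun x => by
    rw [RCLike.mul_conj]
    norm_cast
  simp_rw [e]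
  exact (congrArg Complex.re integral_complex_ofReal).symm

/-- The point of radius `r` and angle `x`. -/
def polar (r : ℝ) (hr0 : 0 ≤ r) (hr1 : r < 1) (x : AddCircle (1 : ℝ)) : Complex.UnitDisc :=
  Complex.UnitDisc.mk ((r : ℂ) * (fourier 1 x : ℂ)) (by
    rw [norm_mul, fourier_one, Circle.norm_coe, mul_one, Complex.norm_real,
      Real.norm_of_nonneg hr0]
    exact hr1)

@[simp] theorem coe_polar (r : ℝ) (hr0 : 0 ≤ r) (hr1 : r < 1) (x : AddCircle (1 : ℝ)) :
    (polar r hr0 hr1 x : ℂ) = r * (fourier 1 x : ℂ) := rfl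

theorem hasSum_norm_sq_polar (f : H2) {r : ℝ} (hr0 : 0 ≤ r) (hr1 : r < 1) :
    Continuous (fun x => f (polar r hr0 hr1 x)) ∧
      HasSum (fun k => ‖f.coeff k‖ ^ 2 * (r ^ 2) ^ k)
        (∫ x, ‖f (polar r hr0 hr1 x)‖ ^ 2 ∂(AddCircle.haarAddCircle (T := 1))) := by
  have h1 : ∀ x, HasSum (fun k : ℕ => (f.coeff k * (r : ℂ) ^ k) * (fourier k x : ℂ))
      (f (polar r hr0 hr1 x)) := by
    intro x
    refine (f.hasCoeffs.2 (polar r hr0 hr1 x)).congr_fun fun k => ?_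
    rw [coe_polar, mul_pow, mul_assoc, fourier_one, fourier_apply, natCast_zsmul,
      AddCircle.toCircle_nsmul, Circle.coe_pow]
  have h0 : Summable fun k => ‖f.coeff k * (r : ℂ) ^ k‖ := by
    refine summable_norm_iff.2 ?_
    simpa using (h1 0).summable
  obtain ⟨hc, hs⟩ := hasSum_norm_sq h0 h1
  refine ⟨hc, hs.congr_fun fun k => ?_⟩
  rw [norm_mul, norm_pow, Complex.norm_real, mul_pow, Real.norm_of_nonneg hr0]
  ring

/-- The `H²` norm is the limit of the `L²` means over circles. -/
theorem tendsto_integral_polar (f : H2) {r : ℕ → ℝ} (hr0 : ∀ n, 0 ≤ r n) (hr1 : ∀ n, r n < 1)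
    (hr : Tendsto r atTop (𝓝 1)) :
    Tendsto (fun n => ∫ x, ‖f (polar (r n) (hr0 n) (hr1 n) x)‖ ^ 2
      ∂(AddCircle.haarAddCircle (T := 1))) atTop (𝓝 (‖f‖ ^ 2)) := by
  rw [norm_sq_eq_tsum]
  simp_rw [fun n => (hasSum_norm_sq_polar f (hr0 n) (hr1 n)).2.tsum_eq.symm]
  refine tendsto_tsum_of_dominated_convergence f.hasCoeffs.1 (fun k => ?_)
    (Eventually.of_forall fun n k => ?_)
  · simpa using ((hr.pow 2).pow k).const_mul (‖f.coeff k‖ ^ 2)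
  · rw [Real.norm_of_nonneg (by have := hr0 n; positivity)]
    exact mul_le_of_le_one_right (by positivity)
      (pow_le_one₀ (by positivity) (pow_le_one₀ (hr0 n) (hr1 n).le))

theorem norm_ofPoly_sq (q : ℂ[X]) :
    ∫ x, ‖q.eval (fourier 1 x : ℂ)‖ ^ 2 ∂(AddCircle.haarAddCircle (T := 1)) = ‖ofPoly q‖ ^ 2 := by
  have hs : ∀ k ∉ q.support, q.coeff k = 0 := fun k hk => notMem_support_iff.1 hk
  have h := hasSum_norm_sq (c := q.coeff) (G := fun x => q.eval (fourier 1 x : ℂ))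
    (summable_of_ne_finset_zero (s := q.support) fun k hk => by simp [hs k hk]) (fun x => by
      rw [eval_eq_sum]
      have e : ∀ k : ℕ, (fourier 1 x : ℂ) ^ k = (fourier k x : ℂ) := fun k => by
        rw [fourier_one, fourier_apply, natCast_zsmul, AddCircle.toCircle_nsmul, Circle.coe_pow]
      simp_rw [e, Polynomial.sum]
      exact hasSum_sum_of_ne_finset_zero fun k hk => by simp [hs k hk])
  rw [norm_sq_eq_tsum, ← h.2.tsum_eq, coeff_ofPoly]

/-- The point `-1` is the only boundary singularity of `φ^t`. It has at most one preimage, and Haar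
measure on a nontrivial circle has no atoms. -/
theorem ae_fourier_ne_neg_one :
    ∀ᵐ x ∂(AddCircle.haarAddCircle (T := 1)), (fourier 1 x : ℂ) ≠ -1 := by
  have : Nontrivial Circle := ⟨1, -1, fun h => by
    have h' := congrArg (Subtype.val : Circle → ℂ) h
    norm_num at h'⟩
  have : Nontrivial (AddCircle (1 : ℝ)) :=
    (AddCircle.homeomorphCircle one_ne_zero).toEquiv.nontrivial
  rw [ae_iff]
  refine Set.Subsingleton.measure_zero (fun x hx y hy => ?_) _
  simp only [not_not, Set.mem_ofPred_eq, fourier_one] at hx hy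
  exact AddCircle.injective_toCircle one_ne_zero (Subtype.ext (hx.trans hy.symm))

theorem phi_apply (t : ℝ≥0) (z : Complex.UnitDisc) :
    (phi t).1 z = Complex.exp (-(t : ℂ) * ((1 - z) / (1 + z))) := rfl

theorem norm_phi_le_one (t : ℝ≥0) (z : Complex.UnitDisc) : ‖(phi t).1 z‖ ≤ 1 := by
  rw [phi_apply, Complex.norm_exp, Real.exp_le_one_iff]
  have h : 0 ≤ ((1 - (z : ℂ)) / (1 + z)).re := by
    have hz := z.normSq_lt_one
    rw [Complex.normSq_apply] at hz
    rw [Complex.div_re, ← add_div]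
    refine div_nonneg ?_ (Complex.normSq_nonneg _)
    simp only [Complex.sub_re, Complex.one_re, Complex.add_re, Complex.sub_im,
      Complex.one_im, Complex.add_im]
    nlinarith
  rw [← Complex.ofReal_neg, Complex.re_ofReal_mul]
  nlinarith [mul_nonneg t.2 h]

theorem norm_exp_of_norm_eq_one (t : ℝ) {z : ℂ} (hz : ‖z‖ = 1) :
    ‖Complex.exp (-(t : ℂ) * ((1 - z) / (1 + z)))‖ = 1 := by
  have h : ((1 - z) / (1 + z)).re = 0 := by
    have hz' : Complex.normSq z = 1 := by rw [Complex.normSq_eq_norm_sq, hz, one_pow]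
    rw [Complex.normSq_apply] at hz'
    rw [Complex.div_re, ← add_div, div_eq_zero_iff]
    left
    simp only [Complex.sub_re, Complex.one_re, Complex.add_re, Complex.sub_im,
      Complex.one_im, Complex.add_im]
    nlinarith
  rw [Complex.norm_exp, ← Complex.ofReal_neg, Complex.re_ofReal_mul, h, mul_zero, Real.exp_zero]

/-- A polynomial is bounded on the closed disc and `φ^t` is continuous and unimodular on the circle
away from `-1`, so dominated convergence of the means over radii `r n → 1` suffices. Restricting to
polynomials avoids boundary values of general `H²` functions; density does the rest. -/
theorem norm_mulCLM_phi_ofPoly (t : ℝ≥0) (q : ℂ[X]) : ‖mulCLM (phi t) (ofPoly q)‖ = ‖ofPoly q‖ := by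
  let r : ℕ → ℝ := fun n => 1 - 1 / ((n : ℝ) + 1)
  have hr0 : ∀ n, 0 ≤ r n := fun n => by
    have : 1 / ((n : ℝ) + 1) ≤ 1 := by
      rw [div_le_one (by positivity)]
      linarith [n.cast_nonneg (α := ℝ)]
    simp only [r]
    linarith
  have hr1 : ∀ n, r n < 1 := fun n => by
    have : 0 < 1 / ((n : ℝ) + 1) := by positivity
    simp only [r]
    linarith
  have hr : Tendsto r atTop (𝓝 1) := by
    simpa [r] using tendsto_one_div_add_atTop_nhds_zero_nat.const_sub (1 : ℝ)
  obtain ⟨C, hC⟩ := (isCompact_closedBall (0 : ℂ) 1).exists_bound_of_continuousOn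
    (q.continuous.continuousOn)
  have h1 := tendsto_integral_polar (mulCLM (phi t) (ofPoly q)) hr0 hr1 hr
  have h2 : Tendsto (fun n => ∫ x, ‖mulCLM (phi t) (ofPoly q) (polar (r n) (hr0 n) (hr1 n) x)‖ ^ 2
      ∂(AddCircle.haarAddCircle (T := 1))) atTop (𝓝 (‖ofPoly q‖ ^ 2)) := by
    rw [← norm_ofPoly_sq]
    refine tendsto_integral_of_dominated_convergence (fun _ => C ^ 2) (fun n => ?_)
      (integrable_const _) (fun n => ae_of_all _ fun x => ?_) ?_
    · exact ((hasSum_norm_sq_polar _ (hr0 n) (hr1 n)).1.norm.pow 2).aestronglyMeasurable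
    · rw [Real.norm_of_nonneg (by positivity), mulCLM_apply, norm_mul]
      gcongr
      refine (mul_le_of_le_one_left (norm_nonneg _) (norm_phi_le_one _ _)).trans (hC _ ?_)
      rw [mem_closedBall_zero_iff]
      exact (Complex.UnitDisc.norm_lt_one _).le
    · filter_upwards [ae_fourier_ne_neg_one] with x hx
      have hn : ‖(fourier 1 x : ℂ)‖ = 1 := by rw [fourier_one, Circle.norm_coe]
      have hne : 1 + (fourier 1 x : ℂ) ≠ 0 := fun h => hx (eq_neg_of_add_eq_zero_right h)
      have hcont : ContinuousAt (fun z : ℂ =>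
          ‖Complex.exp (-(t : ℂ) * ((1 - z) / (1 + z))) * q.eval z‖ ^ 2) (fourier 1 x : ℂ) := by
        have := q.continuous.continuousAt (x := (fourier 1 x : ℂ))
        fun_prop (disch := assumption)
      have hlim : Tendsto (fun n => (r n : ℂ) * (fourier 1 x : ℂ)) atTop (𝓝 (fourier 1 x : ℂ)) := by
        simpa using ((Complex.continuous_ofReal.tendsto 1).comp hr).mul_const (fourier 1 x : ℂ)
      have h3 := hcont.tendsto.comp hlim
      rw [norm_mul, norm_exp_of_norm_eq_one _ hn, one_mul] at h3
      exact h3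
  exact (sq_eq_sq₀ (norm_nonneg _) (norm_nonneg _)).1 (tendsto_nhds_unique h1 h2)

/-- Multiplication by the inner function `φ ^ t` is isometric. -/
theorem norm_mulCLM_phi (t : ℝ≥0) (f : H2) : ‖mulCLM (phi t) f‖ = ‖f‖ :=
  denseRange_ofPoly.induction_on (p := fun f => ‖mulCLM (phi t) f‖ = ‖f‖) f
    (isClosed_eq (by fun_prop) (by fun_prop)) (norm_mulCLM_phi_ofPoly t)

theorem inner_mulCLM_phi (t : ℝ≥0) (f g : H2) :
    ⟪mulCLM (phi t) f, mulCLM (phi t) g⟫_ℂ = ⟪f, g⟫_ℂ :=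
  LinearIsometry.inner_map_map ⟨(mulCLM (phi t)).toLinearMap, norm_mulCLM_phi t⟩ f g

/-! ### The semigroup `φ^t` and the density of its span. -/

theorem phi_add (s t : ℝ≥0) : phi (s + t) = phi s * phi t := by
  refine Subtype.ext (funext fun z => ?_)
  change (phi (s + t)).1 z = (phi s).1 z * (phi t).1 z
  rw [phi_apply, phi_apply, phi_apply, ← Complex.exp_add]
  push_cast
  ring_nf

theorem phi_zero_apply (t : ℝ≥0) : (phi t).1 0 = Real.exp (-t) := by
  simp [phi_apply]

theorem inner_phi_phi {s t : ℝ≥0} (h : s ≤ t) :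
    ⟪mulCLM (phi s) one, mulCLM (phi t) one⟫_ℂ = Real.exp (-(t - s)) := by
  obtain ⟨r, rfl⟩ := exists_add_of_le h
  rw [phi_add, mulCLM_mul, inner_mulCLM_phi, inner_one, mulCLM_apply, phi_zero_apply]
  simp

theorem norm_one : ‖one‖ = 1 := by
  have h := norm_sq_eq_re_inner (𝕜 := ℂ) one
  rw [inner_one] at h
  simp only [one_apply, RCLike.one_re] at h
  nlinarith [norm_nonneg one]

theorem norm_sub_phi_sq (s t : ℝ≥0) :
    ‖mulCLM (phi s) one - mulCLM (phi t) one‖ ^ 2 = 2 - 2 * Real.exp (-|(t : ℝ) - s|) := by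
  wlog h : s ≤ t generalizing s t
  · rw [norm_sub_rev, this t s (le_of_not_ge h), abs_sub_comm]
  rw [norm_sub_sq (𝕜 := ℂ), norm_mulCLM_phi, norm_mulCLM_phi, norm_one, inner_phi_phi h,
    abs_of_nonneg (sub_nonneg.2 (NNReal.coe_le_coe.2 h))]
  simp only [RCLike.re_eq_complex_re, Complex.ofReal_re]
  ring

/-- The semigroup `t ↦ φ ^ t` is norm continuous in `H²`. -/
theorem continuous_phi : Continuous fun t : ℝ≥0 => mulCLM (phi t) one := by
  refine continuous_iff_continuousAt.2 fun s => tendsto_iff_norm_sub_tendsto_zero.2 ?_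
  have h : Tendsto (fun t : ℝ≥0 => √(2 - 2 * Real.exp (-|(s : ℝ) - t|))) (𝓝 s) (𝓝 0) := by
    have : Continuous fun t : ℝ≥0 => √(2 - 2 * Real.exp (-|(s : ℝ) - t|)) := by fun_prop
    simpa using this.tendsto s
  refine h.congr fun t => ?_
  rw [← norm_sub_phi_sq, Real.sqrt_sq (norm_nonneg _)]

theorem integrable_exp_smul_phi (s : ℝ≥0) : IntegrableOn (fun t : ℝ =>
    ((Real.exp (-t) : ℝ) : ℂ) • mulCLM (phi (s + t.toNNReal)) one) (Set.Ioi 0) := by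
  refine Integrable.mono (integrableOn_exp_neg_Ioi 0) ?_ (ae_of_all _ fun t => ?_)
  · have h : Continuous fun t : ℝ => mulCLM (phi (s + t.toNNReal)) one :=
      continuous_phi.comp (continuous_const.add continuous_real_toNNReal)
    have h2 : Continuous fun t : ℝ => ((Real.exp (-t) : ℝ) : ℂ) := by fun_prop
    exact (h2.smul h).aestronglyMeasurable
  · rw [norm_smul, norm_mulCLM_phi, norm_one, mul_one, Complex.norm_real]

/-- Evaluation at `z` commutes with the integral and leaves a scalar exponential with rate `1 + (1 -
z)/(1 + z) = 2/(1 + z)`, whose integral is `(1 + z)/2`. -/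
theorem integral_exp_smul_phi (s : ℝ≥0) : ∫ t in Set.Ioi (0 : ℝ),
    ((Real.exp (-t) : ℝ) : ℂ) • mulCLM (phi (s + t.toNNReal)) one =
      (1 / 2 : ℂ) • (mulCLM coord (mulCLM (phi s) one) + mulCLM (phi s) one) := by
  refine H2.ext fun z => ?_
  have hz := Complex.UnitDisc.one_add_coe_ne_zero z
  rw [← eval_apply, ← (eval z).integral_comp_comm (integrable_exp_smul_phi s)]
  let r : ℂ := -(2 / (1 + z))
  have hr : r.re < 0 := by
    have h1 : 0 < (1 + (z : ℂ)).re := by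
      have := abs_lt.1 ((Complex.abs_re_le_norm _).trans_lt z.norm_lt_one)
      rw [Complex.add_re, Complex.one_re]
      linarith
    rw [Complex.neg_re, neg_lt_zero, Complex.div_re]
    simp only [Complex.re_ofNat, Complex.im_ofNat, zero_mul, zero_div, add_zero]
    exact div_pos (mul_pos two_pos h1) (Complex.normSq_pos.2 hz)
  have e : ∫ t in Set.Ioi (0 : ℝ), eval z (((Real.exp (-t) : ℝ) : ℂ) •
      mulCLM (phi (s + t.toNNReal)) one) =
      ∫ t in Set.Ioi (0 : ℝ), (phi s).1 z * Complex.exp (r * t) := by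
    refine setIntegral_congr_fun measurableSet_Ioi fun t ht => ?_
    have ht' : ((t.toNNReal : ℝ) : ℂ) = t := by rw [Real.coe_toNNReal _ (le_of_lt ht)]
    change ((Real.exp (-t) : ℝ) : ℂ) * ((phi (s + t.toNNReal)).1 z * 1) = _
    rw [phi_add, mul_one]
    change _ * ((phi s).1 z * (phi t.toNNReal).1 z) = _
    rw [mul_left_comm, phi_apply t.toNNReal, ht', Complex.ofReal_exp, ← Complex.exp_add]
    congr 2
    simp only [r]
    push_cast
    field_simp
    ring
  rw [e, integral_const_mul, integral_exp_mul_complex_Ioi hr 0]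
  change _ = (1 / 2 : ℂ) * ((z : ℂ) * ((phi s).1 z * 1) + (phi s).1 z * 1)
  simp only [r, Complex.ofReal_zero, mul_zero, Complex.exp_zero]
  field_simp
  ring

theorem coeff_adjoint_coord (f : H2) (k : ℕ) :
    ((mulCLM coord).adjoint f).coeff k = f.coeff (k + 1) := by
  rw [← inner_ofPoly_X_pow, ContinuousLinearMap.adjoint_inner_right, ← pow_one coord,
    mulCLM_coord_pow, ← pow_add, inner_ofPoly_X_pow, add_comm]

/-- The functions `φ ^ t` with `t ≥ 0` have dense span in `H²`. -/
theorem eq_zero_of_inner_phi {f : H2} (h : ∀ t : ℝ≥0, ⟪mulCLM (phi t) one, f⟫_ℂ = 0) : f = 0 := by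
  -- The function is quantified inside the induction, which replaces `f` by its backward shift.
  have key : ∀ (k : ℕ) (f : H2), (∀ t : ℝ≥0, ⟪mulCLM (phi t) one, f⟫_ℂ = 0) →
      f.coeff k = 0 := by
    intro k
    induction k with
    | zero =>
      intro f hf
      have e : mulCLM (phi 0) one = ofPoly (X ^ 0) := H2.ext fun z => by simp [phi_apply]
      rw [← inner_ofPoly_X_pow, ← e, hf]
    | succ k ih =>
      intro f hf
      rw [← coeff_adjoint_coord]
      refine ih _ fun s => ?_
      have hf' : ∀ t : ℝ≥0, ⟪f, mulCLM (phi t) one⟫_ℂ = 0 := fun t => inner_eq_zero_symm.1 (hf t)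
      -- By the Laplace integral `z φ^s + φ^s` is orthogonal to `f`, and so is `φ^s`; hence so is `z
      -- φ^s`.
      have h1 := integral_inner (𝕜 := ℂ) (integrable_exp_smul_phi s) f
      simp only [inner_smul_right, hf', mul_zero, integral_zero] at h1
      rw [integral_exp_smul_phi, inner_smul_right, inner_add_right, hf', add_zero] at h1
      rw [ContinuousLinearMap.adjoint_inner_right]
      exact inner_eq_zero_symm.1 ((mul_eq_zero.1 h1.symm).resolve_left (by norm_num))
  refine ext_coeff fun k => ?_
  rw [key k f h, ← inner_ofPoly_X_pow, inner_zero_right]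

/-- A function orthogonal to `φ ^ t` for `0 ≤ t ≤ δ` is divisible by `φ ^ δ`. -/
theorem eq_mulCLM_adjoint {δ : ℝ≥0} {f : H2}
    (h : ∀ t ≤ δ, ⟪mulCLM (phi t) one, f⟫_ℂ = 0) :
    f = mulCLM (phi δ) ((mulCLM (phi δ)).adjoint f) := by
  rw [← sub_eq_zero]
  refine eq_zero_of_inner_phi fun t => ?_
  rw [inner_sub_right]
  rcases le_total t δ with ht | ht
  · have h0 : ((mulCLM (phi δ)).adjoint f) 0 = 0 := by
      rw [← inner_one, ContinuousLinearMap.adjoint_inner_right, h δ le_rfl]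
    rw [h t ht]
    generalize (mulCLM (phi δ)).adjoint f = g at h0 ⊢
    obtain ⟨s, rfl⟩ := exists_add_of_le ht
    rw [phi_add, mulCLM_mul, inner_mulCLM_phi, inner_one, mulCLM_apply, h0]
    simp
  · obtain ⟨s, rfl⟩ := exists_add_of_le ht
    rw [phi_add, mulCLM_mul, inner_mulCLM_phi, ContinuousLinearMap.adjoint_inner_right, sub_self]

/-! ### The polynomial is outer. -/

theorem denseRange_mulCLM_iff {u : Hinf} :
    DenseRange (mulCLM u) ↔ ∀ f, (mulCLM u).adjoint f = 0 → f = 0 := by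
  change Dense ((LinearMap.range (mulCLM u).toLinearMap : Submodule ℂ H2) : Set H2) ↔ _
  rw [Submodule.dense_iff_topologicalClosure_eq_top, Submodule.topologicalClosure_eq_top_iff,
    Submodule.eq_bot_iff]
  refine forall_congr' fun f => imp_congr_left ?_
  rw [(mulCLM u).orthogonal_range]
  rfl

/-- A vector in the kernel of the adjoint has coefficients of constant modulus, since `|w| = 1`;
square summability forces them to vanish. -/
theorem denseRange_coord_add (w : Circle) :
    DenseRange (mulCLM (coord + algebraMap ℂ Hinf w)) := by
  refine denseRange_mulCLM_iff.2 fun f hf => ?_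
  have hrec : ∀ k, ‖f.coeff (k + 1)‖ = ‖f.coeff k‖ := by
    intro k
    have h1 : ⟪mulCLM (coord + algebraMap ℂ Hinf w) (ofPoly (X ^ k)), f⟫_ℂ = 0 := by
      rw [← ContinuousLinearMap.adjoint_inner_right, hf, inner_zero_right]
    have e : mulCLM (coord + algebraMap ℂ Hinf w) (ofPoly (X ^ k)) =
        ofPoly (X ^ (k + 1)) + (w : ℂ) • ofPoly (X ^ k) := H2.ext fun z => by
      change ((z : ℂ) + w) * _ = _
      simp
      ring
    rw [e, inner_add_left, inner_smul_left, inner_ofPoly_X_pow, inner_ofPoly_X_pow] at h1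
    rw [eq_neg_of_add_eq_zero_left h1, norm_neg, norm_mul, RCLike.norm_conj, Circle.norm_coe,
      one_mul]
  have hconst : ∀ k, ‖f.coeff k‖ = ‖f.coeff 0‖ := fun k => by
    induction k with
    | zero => rfl
    | succ k ih => rw [hrec, ih]
  have hs := f.hasCoeffs.1
  simp only [hconst] at hs
  have h0 := (summable_const_iff _).1 hs
  refine H2.ext_coeff fun k => ?_
  rw [← inner_ofPoly_X_pow k 0, inner_zero_right, ← norm_eq_zero, hconst]
  simpa using h0

theorem denseRange_polyTilde {N : ℕ} (w : Fin N → Circle) : DenseRange (mulCLM (polyTilde w)) := by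
  refine Finset.prod_induction _ (fun u => DenseRange (mulCLM u)) (fun u v hu hv => ?_) ?_
    fun j _ => denseRange_coord_add (w j)
  · rw [show ⇑(mulCLM (u * v)) = mulCLM u ∘ mulCLM v from funext (mulCLM_mul u v)]
    exact hu.comp hv (mulCLM u).continuous
  · exact fun f => subset_closure ⟨f, H2.ext fun z => one_mul _⟩

/-! ### Model spaces of powers of `z`. -/

theorem mem_modelSpace {u : Hinf} {f : H2} :
    f ∈ modelSpace u ↔ ∀ g, ⟪mulCLM u g, f⟫_ℂ = 0 :=
  ⟨fun h g => h _ ⟨g, rfl⟩, by rintro h _ ⟨g, rfl⟩; exact h g⟩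

theorem coeff_mulCLM_coord_pow {N k : ℕ} (hk : k < N) (f : H2) :
    (mulCLM (coord ^ N) f).coeff k = 0 := by
  rw [← inner_ofPoly_X_pow]
  refine denseRange_ofPoly.induction_on
    (p := fun f => ⟪ofPoly (X ^ k), mulCLM (coord ^ N) f⟫_ℂ = 0) f
    (isClosed_eq (by fun_prop) continuous_const) fun q => ?_
  rw [mulCLM_coord_pow, inner_ofPoly_X_pow, coeff_ofPoly, coeff_X_pow_mul', if_neg hk.not_ge]

theorem ofPoly_mem_modelSpace {N : ℕ} {q : ℂ[X]} (hq : q.degree < N) :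
    ofPoly q ∈ modelSpace (coord ^ N) := by
  refine mem_modelSpace.2 fun f => inner_eq_zero_symm.1 ?_
  rw [inner_eq_tsum, ← tsum_zero (α := ℂ) (β := ℕ)]
  refine tsum_congr fun k => ?_
  rcases lt_or_ge k N with hk | hk
  · rw [coeff_mulCLM_coord_pow hk, mul_zero]
  · rw [coeff_ofPoly, coeff_eq_zero_of_degree_lt (hq.trans_le (Nat.cast_le.2 hk)), map_zero,
      zero_mul]

theorem coeff_eq_zero_of_mem_modelSpace {N k : ℕ} {f : H2} (hf : f ∈ modelSpace (coord ^ N))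
    (hk : N ≤ k) : f.coeff k = 0 := by
  rw [← inner_ofPoly_X_pow, ← Nat.add_sub_cancel' hk, pow_add, ← mulCLM_coord_pow]
  exact mem_modelSpace.1 hf _

theorem modelSpace_coord_pow (N : ℕ) :
    modelSpace (coord ^ N) = (degreeLT ℂ N).map ofPoly := by
  refine le_antisymm (fun f hf => ?_) ?_
  · refine ⟨∑ k ∈ Finset.range N, monomial k (f.coeff k), ?_, ?_⟩
    · exact Submodule.sum_mem _ fun k hk => mem_degreeLT.2
        ((degree_monomial_le _ _).trans_lt (Nat.cast_lt.2 (Finset.mem_range.1 hk)))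
    · refine ext_coeff fun k => ?_
      rw [coeff_ofPoly, finsetSum_coeff]
      simp only [coeff_monomial, Finset.sum_ite_eq', Finset.mem_range]
      split_ifs with h
      · rfl
      · exact (coeff_eq_zero_of_mem_modelSpace hf (not_lt.1 h)).symm
  · rintro _ ⟨q, hq, rfl⟩
    exact ofPoly_mem_modelSpace (mem_degreeLT.1 hq)

/-- Makes the algebraic sum in the theorem closed. -/
instance finiteDimensional_modelSpace (N : ℕ) : FiniteDimensional ℂ (modelSpace (coord ^ N)) := by
  have : FiniteDimensional ℂ (degreeLT ℂ N) := (degreeLTEquiv ℂ N).symm.finiteDimensional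
  rw [modelSpace_coord_pow]
  infer_instance

theorem rank_modelSpace_coord_pow_le (N : ℕ) : Module.rank ℂ (modelSpace (coord ^ N)) ≤ N := by
  rw [modelSpace_coord_pow]
  refine (rank_map_le _ _).trans_eq ?_
  rw [(degreeLTEquiv ℂ N).rank_eq, rank_fin_fun]

/-- The polynomial underlying `polyTilde`. -/
def rootPoly {N : ℕ} (w : Fin N → Circle) : ℂ[X] := ∏ j, (X + C (w j : ℂ))

theorem monic_rootPoly {N : ℕ} (w : Fin N → Circle) : (rootPoly w).Monic :=
  monic_prod_of_monic _ _ fun _ _ => monic_X_add_C _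

theorem natDegree_rootPoly {N : ℕ} (w : Fin N → Circle) : (rootPoly w).natDegree = N := by
  rw [rootPoly, natDegree_prod_of_monic _ _ fun _ _ => monic_X_add_C _]
  simp

theorem mulCLM_polyTilde_one {N : ℕ} (w : Fin N → Circle) :
    mulCLM (polyTilde w) one = ofPoly (rootPoly w) := H2.ext fun z => by
  simp [polyTilde_apply, rootPoly, eval_prod]

/-! ### The decomposition and the codimension bound. -/

theorem adjoint_mulCLM_comm (u v : Hinf) (f : H2) :
    (mulCLM u).adjoint ((mulCLM v).adjoint f) = (mulCLM v).adjoint ((mulCLM u).adjoint f) :=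
  ext_inner_left ℂ fun g => by
    simp only [ContinuousLinearMap.adjoint_inner_right, mulCLM_comm]

theorem isClosed_modelSpace (u : Hinf) : IsClosed (modelSpace u : Set H2) :=
  Submodule.isClosed_orthogonal _

/-- With `δ = t + s`, cancelling the isometry `φ^t` leaves the product of `z^{N+1} φ^s g` with `p`,
which is zero because `deg p = N`. -/
theorem cyclicSpace_le_modelSpace (δ : ℝ≥0) {N : ℕ} (w : Fin N → Circle) :
    cyclicSpace δ (polyTilde w) ≤ modelSpace (coord ^ (N + 1) * phi δ) := by
  refine Submodule.topologicalClosure_minimal _ (Submodule.span_le.2 ?_) (isClosed_modelSpace _)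
  rintro _ ⟨t, ht, rfl⟩
  refine mem_modelSpace.2 fun g => ?_
  obtain ⟨s, rfl⟩ := exists_add_of_le ht.2
  change ⟪_, mulCLM (polyTilde w * phi t) one⟫_ℂ = 0
  rw [mulCLM_mul, mulCLM_comm, mulCLM_mul (polyTilde w), mulCLM_comm (polyTilde w), phi_add, mulCLM_mul,
    inner_mulCLM_phi, mulCLM_comm, mulCLM_polyTilde_one]
  refine mem_modelSpace.1 (ofPoly_mem_modelSpace ?_) _
  rw [degree_eq_natDegree (monic_rootPoly w).ne_zero, natDegree_rootPoly]
  exact_mod_cast N.lt_succ_self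

/-- Cancel the isometry `φ^δ` and use `z^{N+1} H² ⊆ z^N H²`. -/
theorem map_modelSpace_le (δ : ℝ≥0) (N : ℕ) :
    (modelSpace (coord ^ N)).map (mul (phi δ)) ≤ modelSpace (coord ^ (N + 1) * phi δ) := by
  rintro _ ⟨f, hf, rfl⟩
  refine mem_modelSpace.2 fun g => ?_
  rw [← mulCLM_eq_mul, mulCLM_mul, mulCLM_comm, inner_mulCLM_phi, pow_succ, mulCLM_mul]
  exact mem_modelSpace.1 hf _

theorem eq_zero_of_orthogonal (δ : ℝ≥0) {N : ℕ} (w : Fin N → Circle) {g : H2}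
    (hg : g ∈ modelSpace (coord ^ (N + 1) * phi δ))
    (h1 : g ∈ (cyclicSpace δ (polyTilde w))ᗮ)
    (h2 : g ∈ ((modelSpace (coord ^ N)).map (mul (phi δ)))ᗮ) : g = 0 := by
  have hp : ∀ t ≤ δ, ⟪mulCLM (polyTilde w) (mulCLM (phi t) one), g⟫_ℂ = 0 := fun t ht => by
    rw [← mulCLM_mul]
    exact h1 _ (Submodule.le_topologicalClosure _
      (Submodule.subset_span ⟨t, ⟨zero_le, ht⟩, rfl⟩))
  have hv : (mulCLM (phi δ)).adjoint g ∈ modelSpace (coord ^ (N + 1)) :=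
    mem_modelSpace.2 fun f => by
      rw [ContinuousLinearMap.adjoint_inner_right, mulCLM_comm, ← mulCLM_mul]
      exact mem_modelSpace.1 hg f
  have hlow : ∀ k < N, ((mulCLM (phi δ)).adjoint g).coeff k = 0 := fun k hk => by
    rw [← inner_ofPoly_X_pow, ContinuousLinearMap.adjoint_inner_right]
    refine h2 _ ⟨_, ofPoly_mem_modelSpace ?_, rfl⟩
    rw [degree_X_pow]
    exact_mod_cast hk
  -- Pairing with `p φ^δ` sees only the coefficient of index `N`, the others being already zero, and
  -- it is weighted by the leading coefficient `1` of `p`.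
  have hN : ((mulCLM (phi δ)).adjoint g).coeff N = 0 := by
    have h := hp δ le_rfl
    rw [mulCLM_comm, mulCLM_polyTilde_one, ← ContinuousLinearMap.adjoint_inner_right,
      inner_eq_tsum, tsum_eq_single N, coeff_ofPoly] at h
    · have hc : (rootPoly w).coeff N = 1 := by
        have := (monic_rootPoly w).coeff_natDegree
        rwa [natDegree_rootPoly] at this
      simpa [hc] using h
    · intro k hk
      rcases lt_or_gt_of_ne hk with hk | hk
      · rw [hlow k hk, mul_zero]
      · rw [coeff_eq_zero_of_mem_modelSpace hv hk, mul_zero]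
  have hzero : (mulCLM (phi δ)).adjoint g = 0 := by
    refine ext_coeff fun k => ?_
    rw [← inner_ofPoly_X_pow k 0, inner_zero_right]
    rcases lt_trichotomy k N with hk | rfl | hk
    · exact hlow k hk
    · exact hN
    · exact coeff_eq_zero_of_mem_modelSpace hv hk
  -- Since `p` is outer, `T_p* g = 0` is enough; `T_p* g` is divisible by `φ^δ`, and its quotient is
  -- `T_p*` applied to zero.
  refine denseRange_mulCLM_iff.1 (denseRange_polyTilde w) g ?_
  rw [eq_mulCLM_adjoint (δ := δ) (f := (mulCLM (polyTilde w)).adjoint g) fun t ht => by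
    rw [ContinuousLinearMap.adjoint_inner_right, hp t ht],
    adjoint_mulCLM_comm, hzero, map_zero, map_zero]

theorem cyclicSpace_sup_map_modelSpace (δ : ℝ≥0) {N : ℕ} (w : Fin N → Circle) :
    cyclicSpace δ (polyTilde w) ⊔ (modelSpace (coord ^ N)).map (mul (phi δ)) =
      modelSpace (coord ^ (N + 1) * phi δ) := by
  have hle := sup_le (cyclicSpace_le_modelSpace δ w) (map_modelSpace_le δ N)
  have hcl : IsClosed ((cyclicSpace δ (polyTilde w) ⊔
      (modelSpace (coord ^ N)).map (mul (phi δ)) : Submodule ℂ H2) : Set H2) :=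
    Submodule.isClosed_sup_finiteDimensional _ _ (Submodule.isClosed_topologicalClosure _)
  -- Completeness supplies the orthogonal projection that splits the model space into the sum and
  -- its relative orthogonal complement.
  have : CompleteSpace (cyclicSpace δ (polyTilde w) ⊔
      (modelSpace (coord ^ N)).map (mul (phi δ)) : Submodule ℂ H2) :=
    hcl.completeSpace_coe
  refine le_antisymm hle ?_
  have h := Submodule.sup_orthogonal_inf_of_hasOrthogonalProjection hle
  rw [← h]
  refine sup_le le_rfl fun g hg => ?_
  rw [← Submodule.inf_orthogonal] at hg
  rw [eq_zero_of_orthogonal δ w hg.2 hg.1.1 hg.1.2]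
  exact zero_mem _

/-- If `B = C ⊔ W` then the dimension of `B / C` is at most that of `W`. -/
theorem rank_quotient_le_of_sup_eq {K V : Type*} [Field K] [AddCommGroup V] [Module K V]
    {B C W : Submodule K V} (h : C ⊔ W = B) :
    Module.rank K (B ⧸ C.submoduleOf B) ≤ Module.rank K W := by
  refine LinearMap.rank_le_of_surjective
    ((C.submoduleOf B).mkQ ∘ₗ Submodule.inclusion (h ▸ le_sup_right)) fun x => ?_
  obtain ⟨⟨b, hb⟩, rfl⟩ := Submodule.mkQ_surjective _ x
  obtain ⟨c, hc, y, hy, rfl⟩ := Submodule.mem_sup.1 (h.symm ▸ hb)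
  refine ⟨⟨y, hy⟩, (Submodule.Quotient.eq _).2 ?_⟩
  change y - (c + y) ∈ C
  simpa using hc

end

end Hardy

theorem mainTheorem4 (δ : ℝ≥0) (hδ : 0 < δ) (N : ℕ) (hN : 1 ≤ N) (w : Fin N → Circle) :
    Hardy.cyclicSpace δ (Hardy.polyTilde w) ⊔
        (Hardy.modelSpace (Hardy.coord ^ N)).map (Hardy.mul (Hardy.phi δ)) =
      Hardy.modelSpace (Hardy.coord ^ (N + 1) * Hardy.phi δ) ∧
    Hardy.cyclicSpace δ (Hardy.polyTilde w) ≤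
      Hardy.modelSpace (Hardy.coord ^ (N + 1) * Hardy.phi δ) ∧
    Module.rank ℂ
        (Hardy.modelSpace (Hardy.coord ^ (N + 1) * Hardy.phi δ) ⧸
          (Hardy.cyclicSpace δ (Hardy.polyTilde w)).submoduleOf
            (Hardy.modelSpace (Hardy.coord ^ (N + 1) * Hardy.phi δ))) ≤ N :=
  ⟨Hardy.cyclicSpace_sup_map_modelSpace δ w, Hardy.cyclicSpace_le_modelSpace δ w,
    (Hardy.rank_quotient_le_of_sup_eq (Hardy.cyclicSpace_sup_map_modelSpace δ w)).trans
      ((rank_map_le _ _).trans (Hardy.rank_modelSpace_coord_pow_le N))⟩
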